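/- Let $h$ be a natural number, let $\{S(t):t\ge 0\}$ be an $\mathbb{R}^h$-valued Lévy process (càdlàg paths) and $\{V(t):t\ge 0\}$ a subordinator (a real-valued Lévy process with almost surely nondecreasing paths), defined on the same probability space and independent of each other. Let $$\kappa_S(\theta):=\log\mathbb{E}\big[e^{\langle\theta,S(1)\rangle}\big]\in(-\infty,\infty]\quad(\theta\in\mathbb{R}^h),\qquad \kappa_V(\eta):=\log\mathbb{E}\big[e^{\eta V(1)}\big]\in(-\infty,\infty]\quad(\eta\in\mathbb{R}),$$ and put $\kappa_V(+\infty):=+\infty$. Assume that $\kappa_S$ is finite in a neighbourhood of $0\in\mathbb{R}^h$, that $\kappa_V$ is finite in a neighbourhood of $0\in\mathbb{R}$, and that $\kappa_V'(0)>0$. Assume that $\Lambda:=\kappa_V\circ\kappa_S$ is essentially smooth, i.e. with $\mathcal{D}:=\{\theta\in\mathbb{R}^h:\Lambda(\theta)<\infty\}$, the interior $\mathcal{D}^\circ$ is nonempty, $\Lambda$ is differentiable throughout $\mathcal{D}^\circ$, and $\|\nabla\Lambda(\theta_n)\|\to\infty$ for every sequence $(\theta_n)$ in $\mathcal{D}^\circ$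 that converges to a boundary point of $\mathcal{D}$. Then, as $t\to\infty$, the family $\{S(V(t))/t:t>0\}$ satisfies the large deviation principle with speed $t$ and good rate function $$I_{\mathrm{LD}}(x):=\sup_{\theta\in\mathbb{R}^h}\{\langle\theta,x\rangle-\kappa_V(\kappa_S(\theta))\}.$$ That is, $I_{\mathrm{LD}}:\mathbb{R}^h\to[0,\infty]$ is lower semicontinuous, the level sets $\{x:I_{\mathrm{LD}}(x)\le\eta\}$ are compact for all $\eta\ge0$, and $$\limsup_{t\to\infty}\frac1t\log P\Big(\frac{S(V(t))}{t}\in C\Big)\le-\inf_{x\in C}I_{\mathrm{LD}}(x)\ \text{ for all closed } C\subseteq\mathbb{R}^h,$$ $$\liminf_{t\to\infty}\frac1t\log P\Big(\frac{S(V(t))}{t}\in O\Big)\ge-\inf_{x\in O}I_{\mathrm{LD}}(x)\ \text{ for all open } O\subseteq\mathbb{R}^h.$$ -/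

import Mathlib

open MeasureTheory ProbabilityTheory Filter Topology Set
open scoped NNReal ENNReal RealInnerProductSpace

namespace LevyLDP

/-- A path indexed by `[0, ∞)` is right-continuous with left limits. -/
def IsCadlagPath {E : Type*} [TopologicalSpace E] (x : ℝ≥0 → E) : Prop :=
  (∀ t, ContinuousWithinAt x (Ici t) t) ∧ (∀ t, ∃ l, Tendsto x (𝓝[<] t) (𝓝 l))

/-- Lévy processes: a family of random variables indexed by `[0, ∞)`, starting at `0` almost
surely, with independent and stationary increments and almost surely càdlàg paths. -/
structure IsLevyProcess {Ω E : Type*} [MeasurableSpace Ω] [NormedAddCommGroup E]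
    [MeasurableSpace E] (X : ℝ≥0 → Ω → E) (P : Measure Ω) : Prop where
  measurable : ∀ t, Measurable (X t)
  start_zero : ∀ᵐ ω ∂P, X 0 ω = 0
  indep_increments : HasIndepIncrements X P
  stationary_increments : ∀ s t : ℝ≥0,
    IdentDistrib (fun ω => X (s + t) ω - X s ω) (fun ω => X t ω - X 0 ω) P P
  cadlag : ∀ᵐ ω ∂P, IsCadlagPath (fun t => X t ω)

/-- Subordinators: real-valued Lévy processes with almost surely nondecreasing paths. -/
structure IsSubordinator {Ω : Type*} [MeasurableSpace Ω] (V : ℝ≥0 → Ω → ℝ) (P : Measure Ω) :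
    Prop where
  levy : IsLevyProcess V P
  monotone : ∀ᵐ ω ∂P, Monotone (fun t => V t ω)

/-- The logarithm of the moment generating function, `θ ↦ log 𝔼[exp ⟨θ, X⟩]`, with value `+∞`
where the expectation is infinite. -/
noncomputable def logMGF {Ω E : Type*} [MeasurableSpace Ω] [NormedAddCommGroup E]
    [InnerProductSpace ℝ E] (X : Ω → E) (P : Measure Ω) (θ : E) : EReal :=
  ENNReal.log (∫⁻ ω, ENNReal.ofReal (Real.exp ⟪θ, X ω⟫) ∂P)

/-- The composition `f ∘ g` for `f : ℝ → [-∞, ∞]` and `g` with values in `(-∞, ∞]`, with the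
convention `f (+∞) = +∞`. -/
noncomputable def compTop {E : Type*} (f : ℝ → EReal) (g : E → EReal) (θ : E) : EReal :=
  open Classical in if g θ = ⊤ then ⊤ else f (g θ).toReal

/-- The log moment generating function of a random vector never takes the value `-∞`
(so `compTop` is only used with an inner function valued in `(-∞, ∞]`). -/
theorem logMGF_ne_bot {Ω E : Type*} [MeasurableSpace Ω] [NormedAddCommGroup E]
    [InnerProductSpace ℝ E] [MeasurableSpace E] [BorelSpace E] [SecondCountableTopology E]
    (X : Ω → E) (P : Measure Ω) [IsProbabilityMeasure P] (hX : Measurable X) (θ : E) :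
    logMGF X P θ ≠ ⊥ := by
  unfold logMGF
  rw [Ne, ENNReal.log_eq_bot_iff, lintegral_eq_zero_iff (by fun_prop)]
  intro h
  obtain ⟨ω, hω⟩ := h.exists
  have := Real.exp_pos ⟪θ, X ω⟫
  simp only [Pi.zero_apply, ENNReal.ofReal_eq_zero] at hω
  linarith

/-- The effective domain `{θ : Λ θ < ∞}`. -/
def effDomain {E : Type*} (Λ : E → EReal) : Set E := {θ | Λ θ < ⊤}

/-- Essential smoothness of `Λ : E → (-∞, ∞]`: the interior of the effective domain is nonempty,
`Λ` is differentiable there, and `Λ` is steep. -/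
structure EssentiallySmooth {E : Type*} [NormedAddCommGroup E] [InnerProductSpace ℝ E]
    [CompleteSpace E] (Λ : E → EReal) : Prop where
  ne_bot : ∀ θ, Λ θ ≠ ⊥
  nonempty_interior : (interior (effDomain Λ)).Nonempty
  differentiable : ∀ θ ∈ interior (effDomain Λ), DifferentiableAt ℝ (fun η => (Λ η).toReal) θ
  steep : ∀ (u : ℕ → E) (θ : E), (∀ n, u n ∈ interior (effDomain Λ)) →
    θ ∈ frontier (effDomain Λ) → Tendsto u atTop (𝓝 θ) →
    Tendsto (fun n => ‖gradient (fun η => (Λ η).toReal) (u n)‖) atTop atTop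

/-- The Legendre transform `x ↦ sup_θ (⟨θ, x⟩ - Λ θ)`. -/
noncomputable def legendre {E : Type*} [NormedAddCommGroup E] [InnerProductSpace ℝ E]
    (Λ : E → EReal) (x : E) : EReal :=
  ⨆ θ : E, (((⟪θ, x⟫ : ℝ) : EReal) - Λ θ)

/-- Rate functions: lower semicontinuous with values in `[0, ∞]`. -/
structure IsRateFunction {X : Type*} [TopologicalSpace X] (I : X → EReal) : Prop where
  nonneg : ∀ x, 0 ≤ I x
  lowerSemicontinuous : LowerSemicontinuous I

/-- Good rate functions: rate functions with compact level sets. -/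
structure IsGoodRateFunction {X : Type*} [TopologicalSpace X] (I : X → EReal) : Prop
    extends IsRateFunction I where
  isCompact_level : ∀ η : ℝ, 0 ≤ η → IsCompact {x | I x ≤ (η : EReal)}

/-- The large deviation principle, as `t → ∞`, for a family `B` of random variables with speed
`v` and rate function `I`. -/
structure SatisfiesLDP {Ω X : Type*} [MeasurableSpace Ω] [TopologicalSpace X]
    [MeasurableSpace X] (P : Measure Ω) (B : ℝ≥0 → Ω → X) (v : ℝ≥0 → ℝ) (I : X → EReal) :
    Prop where
  aemeasurable : ∀ t, AEMeasurable (B t) P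
  speed : Tendsto v atTop atTop
  rate : IsRateFunction I
  upper : ∀ C : Set X, IsClosed C →
    limsup (fun t => ((1 / v t : ℝ) : EReal) * ENNReal.log (P {ω | B t ω ∈ C})) atTop
      ≤ -(⨅ x ∈ C, I x)
  lower : ∀ O : Set X, IsOpen O →
    -(⨅ x ∈ O, I x)
      ≤ liminf (fun t => ((1 / v t : ℝ) : EReal) * ENNReal.log (P {ω | B t ω ∈ O})) atTop

end LevyLDP

/-! Conditioning on the independent clock gives `𝔼 exp ⟪θ, S(V(t))⟫ = 𝔼 exp (κ_S(θ) V(t)) = exp (t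
Λ(θ))` for every `t > 0`, so the scaled log moment generating function equals `Λ` exactly and the
theorem is an instance of Gärtner–Ellis. The hypothesis `κ_V'(0) > 0` excludes `V(t) = 0` almost
surely, so the identity also holds, with value `+∞`, where `κ_S(θ) = +∞`. Since `Λ` is itself the
log moment generating function of `S(V(1))`, its convexity and lower semicontinuity come from Hölder
and Fatou.

Upper bound (`limsup_log_measure_le`): finiteness of `Λ` near `0` handles points far away and
compactness the others, so a closed set is covered by finitely many half-spaces, each estimated by
Chernoff.

Lower bound: if `y = ∇Λ(θ)`, the law tilted by `exp ⟪θ, ·⟫` concentrates at `y`, and undoing the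
tilt costs `⟪θ, y⟫ - Λ(θ)` (`eventually_exp_le_measure`). A point `x` of finite rate need not be a
gradient, but minimising `Λ - ⟪·, x⟫ + ε/2 ‖·‖²` yields one close to `x`: steepness keeps the
minimiser `θ` interior, and stationarity reads `∇Λ(θ) = x - εθ` (`exists_hasGradientAt_sub_smul`).
This replaces the usual argument through exposed points. -/

namespace LevyLDP

/-! ### Log moment generating functions -/

section LogMGF

variable {Ω E : Type*} [MeasurableSpace Ω] [NormedAddCommGroup E] [InnerProductSpace ℝ E]
  {P : Measure Ω} {X : Ω → E}

theorem logMGF_zero [IsProbabilityMeasure P] : logMGF X P (0 : E) = 0 := by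
  simp [logMGF]

variable [MeasurableSpace E] [BorelSpace E] [SecondCountableTopology E]

theorem aemeasurable_ofReal_exp_inner (hX : AEMeasurable X P) (θ : E) :
    AEMeasurable (fun ω => ENNReal.ofReal (Real.exp ⟪θ, X ω⟫)) P := by
  fun_prop

/-- Hölder's inequality: the log moment generating function is convex. -/
theorem logMGF_combo_le (hX : AEMeasurable X P) {a b : ℝ} (ha : 0 ≤ a) (hb : 0 ≤ b)
    (hab : a + b = 1) (x y : E) :
    logMGF X P (a • x + b • y) ≤ a * logMGF X P x + b * logMGF X P y := by
  unfold logMGF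
  rw [← ENNReal.log_rpow, ← ENNReal.log_rpow, ← ENNReal.log_mul_add]
  refine ENNReal.log_le_log ?_
  refine le_trans (le_of_eq ?_) (ENNReal.lintegral_mul_norm_pow_le
    (aemeasurable_ofReal_exp_inner hX x) (aemeasurable_ofReal_exp_inner hX y) ha hb hab)
  refine lintegral_congr fun ω => ?_
  rw [ENNReal.ofReal_rpow_of_pos (Real.exp_pos _), ENNReal.ofReal_rpow_of_pos (Real.exp_pos _),
    ← ENNReal.ofReal_mul (by positivity), ← Real.exp_mul, ← Real.exp_mul, ← Real.exp_add,
    inner_add_left, real_inner_smul_left, real_inner_smul_left]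
  ring_nf

/-- Fatou's lemma: the log moment generating function is lower semicontinuous. -/
theorem lowerSemicontinuous_logMGF (hX : AEMeasurable X P) :
    LowerSemicontinuous (logMGF X P) := by
  have key : LowerSemicontinuous fun θ : E => ∫⁻ ω, ENNReal.ofReal (Real.exp ⟪θ, X ω⟫) ∂P := by
    rw [lowerSemicontinuous_iff_le_liminf]
    intro θ
    refine le_trans (lintegral_mono fun ω => ?_)
      (lintegral_liminf_le' fun θ => aemeasurable_ofReal_exp_inner hX θ)
    have hc : Continuous fun η : E => ENNReal.ofReal (Real.exp ⟪η, X ω⟫) :=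
      ENNReal.continuous_ofReal.comp (by fun_prop)
    exact (hc.tendsto θ).liminf_eq.ge
  exact ENNReal.continuous_log.comp_lowerSemicontinuous key ENNReal.log_monotone

end LogMGF

/-! ### Effective domains and Legendre transforms -/

section EReal

theorem coe_toReal_of_mem_effDomain {E : Type*} {Λ : E → EReal} (hbot : ∀ θ, Λ θ ≠ ⊥)
    {θ : E} (hθ : θ ∈ effDomain Λ) :
    ((Λ θ).toReal : EReal) = Λ θ :=
  EReal.coe_toReal hθ.ne (hbot θ)

variable {E : Type*} [NormedAddCommGroup E] [InnerProductSpace ℝ E] {Λ : E → EReal}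

/-- Convexity of an extended-real-valued function, read off on its effective domain. -/
theorem convexOn_toReal (hbot : ∀ θ, Λ θ ≠ ⊥)
    (hconv : ∀ a b : ℝ, 0 ≤ a → 0 ≤ b → a + b = 1 → ∀ x y,
      Λ (a • x + b • y) ≤ a * Λ x + b * Λ y) :
    ConvexOn ℝ (effDomain Λ) fun θ => (Λ θ).toReal := by
  have key : ∀ x ∈ effDomain Λ, ∀ y ∈ effDomain Λ, ∀ a b : ℝ, 0 ≤ a → 0 ≤ b → a + b = 1 →
      Λ (a • x + b • y) ≤ ((a * (Λ x).toReal + b * (Λ y).toReal : ℝ) : EReal) := by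
    intro x hx y hy a b ha hb hab
    have := hconv a b ha hb hab x y
    rwa [← coe_toReal_of_mem_effDomain hbot hx, ← coe_toReal_of_mem_effDomain hbot hy] at this
  have hD : Convex ℝ (effDomain Λ) := fun x hx y hy a b ha hb hab =>
    (key x hx y hy a b ha hb hab).trans_lt (EReal.coe_lt_top _)
  refine ⟨hD, fun x hx y hy a b ha hb hab => ?_⟩
  have := key x hx y hy a b ha hb hab
  rw [← coe_toReal_of_mem_effDomain hbot (hD hx hy ha hb hab)] at this
  exact EReal.coe_le_coe_iff.1 this

theorem lt_legendre_iff (hbot : ∀ θ, Λ θ ≠ ⊥) {x : E} {a : ℝ} :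
    (a : EReal) < legendre Λ x ↔ ∃ θ ∈ effDomain Λ, a < ⟪θ, x⟫ - (Λ θ).toReal := by
  unfold legendre
  rw [lt_iSup_iff]
  refine exists_congr fun θ => ?_
  by_cases hθ : θ ∈ effDomain Λ
  · rw [← coe_toReal_of_mem_effDomain hbot hθ, ← EReal.coe_sub, EReal.coe_lt_coe_iff,
      EReal.toReal_coe]
    simp [hθ]
  · have : Λ θ = ⊤ := by simpa [effDomain] using hθ
    simp [this, hθ]

theorem legendre_le_iff (hbot : ∀ θ, Λ θ ≠ ⊥) {x : E} {a : ℝ} :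
    legendre Λ x ≤ a ↔ ∀ θ ∈ effDomain Λ, ⟪θ, x⟫ - (Λ θ).toReal ≤ a := by
  rw [← not_lt, lt_legendre_iff hbot]
  push Not
  rfl

theorem legendre_nonneg (h0 : Λ 0 = 0) (x : E) : 0 ≤ legendre Λ x := by
  refine le_trans ?_ (le_iSup _ (0 : E))
  simp [h0]

theorem lowerSemicontinuous_legendre (hbot : ∀ θ, Λ θ ≠ ⊥) :
    LowerSemicontinuous (legendre Λ) := by
  refine lowerSemicontinuous_iSup fun θ => ?_
  by_cases hθ : θ ∈ effDomain Λ
  · rw [← coe_toReal_of_mem_effDomain hbot hθ]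
    simp_rw [← EReal.coe_sub]
    have hc : Continuous fun x : E => ⟪θ, x⟫ - (Λ θ).toReal := by fun_prop
    exact (continuous_coe_real_ereal.comp hc).lowerSemicontinuous
  · have : Λ θ = ⊤ := by simpa [effDomain] using hθ
    simp only [this, EReal.sub_top]
    exact lowerSemicontinuous_const

end EReal

/-! ### Half-spaces and the gradient inequality -/

section Convex

variable {E : Type*} [NormedAddCommGroup E] [InnerProductSpace ℝ E]

/-- Finitely many open half-spaces cut out a neighbourhood of the origin inside a given ball. -/
theorem exists_finset_forall_inner_lt [FiniteDimensional ℝ E] {r : ℝ} (hr : 0 < r) :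
    ∃ F : Finset E, ∃ δ > 0, ∀ y : E, (∀ u ∈ F, ⟪u, y⟫ < δ) → ‖y‖ < r := by
  -- Each `u` on the sphere lies in its own half-space, as `⟪u, u⟫ = r² > r² / 2`.
  obtain ⟨F, hF⟩ := (isCompact_sphere (0 : E) r).elim_finite_subcover
    (fun u : E => {y : E | r ^ 2 / 2 < ⟪u, y⟫})
    (fun u => isOpen_lt continuous_const (by fun_prop)) (by
      intro y hy
      rw [mem_sphere_zero_iff_norm] at hy
      refine mem_iUnion.2 ⟨y, ?_⟩
      rw [mem_ofPred_eq, real_inner_self_eq_norm_sq, hy]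
      have := pow_pos hr 2
      linarith)
  refine ⟨F, r ^ 2 / 2, by positivity, fun y hy => ?_⟩
  by_contra! hlt
  have hy0 : 0 < ‖y‖ := hr.trans_le hlt
  have hmem : (r / ‖y‖) • y ∈ Metric.sphere (0 : E) r := by
    rw [mem_sphere_zero_iff_norm, norm_smul, Real.norm_of_nonneg (by positivity)]
    field_simp
  obtain ⟨u, hu, huy⟩ := mem_iUnion₂.1 (hF hmem)
  rw [mem_ofPred_eq, real_inner_smul_right] at huy
  have h1 := hy u hu
  have h2 : r / ‖y‖ ≤ 1 := (div_le_one hy0).2 hlt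
  have h3 : 0 < r / ‖y‖ := by positivity
  have h4 : 0 < r ^ 2 / 2 := by positivity
  nlinarith [mul_lt_mul_of_pos_left h1 h3]

/-- The gradient inequality for convex functions. -/
theorem add_inner_le_of_hasGradientAt [CompleteSpace E] {D : Set E} {f : E → ℝ}
    (hf : ConvexOn ℝ D f) {x y g : E} (hx : x ∈ D) (hy : y ∈ D) (hg : HasGradientAt f g x) :
    f x + ⟪g, y - x⟫ ≤ f y := by
  have hd : HasDerivAt (fun s : ℝ => f (x + s • (y - x))) ⟪g, y - x⟫ 0 := by
    have h1 : HasDerivAt (fun s : ℝ => x + s • (y - x)) (y - x) 0 := by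
      simpa using ((hasDerivAt_id (0 : ℝ)).smul_const (y - x)).const_add x
    have h2 : HasFDerivAt f (InnerProductSpace.toDual ℝ E g) (x + (0 : ℝ) • (y - x)) := by
      simpa using hg.hasFDerivAt
    simpa [Function.comp_def] using h2.comp_hasDerivAt (0 : ℝ) h1
  have hs := hd.tendsto_slope_zero_right
  have : ⟪g, y - x⟫ ≤ f y - f x := by
    refine le_of_tendsto hs ?_
    filter_upwards [Ioo_mem_nhdsGT (zero_lt_one' ℝ)] with s hs
    have hc := hf.2 hx hy (sub_nonneg.2 hs.2.le) hs.1.le (by ring)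
    have e : (1 - s) • x + s • y = x + s • (y - x) := by
      rw [smul_sub, sub_smul, one_smul]; abel
    rw [e] at hc
    simp only [zero_add, zero_smul, add_zero, smul_eq_mul] at hc ⊢
    rw [inv_mul_le_iff₀ hs.1]
    linarith
  linarith

end Convex

/-! ### Exponential Chebyshev bounds -/

section Chernoff

variable {Ω E : Type*} [MeasurableSpace Ω] [NormedAddCommGroup E] [InnerProductSpace ℝ E]
  {P : Measure Ω}

theorem lintegral_exp_inner_eq {X : Ω → E} {θ : E} {a : ℝ} (h : logMGF X P θ = a) :
    ∫⁻ ω, ENNReal.ofReal (Real.exp ⟪θ, X ω⟫) ∂P = ENNReal.ofReal (Real.exp a) := by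
  apply ENNReal.log_injective
  rw [ENNReal.log_ofReal_of_pos (Real.exp_pos a), Real.log_exp]
  exact h

/-- If the log moment generating functions of a family are proportional to time, so are they
exponentiated on the effective domain. -/
theorem lintegral_exp_inner_eq_exp_mul {Z : ℝ≥0 → Ω → E} {Λ : E → EReal} (hbot : ∀ θ, Λ θ ≠ ⊥)
    (hΛ : ∀ t : ℝ≥0, 0 < t → ∀ θ, logMGF (Z t) P θ = ((t : ℝ) : EReal) * Λ θ)
    {t : ℝ≥0} (ht : 0 < t) {θ : E} (hθ : θ ∈ effDomain Λ) :
    ∫⁻ ω, ENNReal.ofReal (Real.exp ⟪θ, Z t ω⟫) ∂P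
      = ENNReal.ofReal (Real.exp (t * (Λ θ).toReal)) := by
  refine lintegral_exp_inner_eq ?_
  rw [hΛ t ht θ, EReal.coe_mul, coe_toReal_of_mem_effDomain hbot hθ]

variable [MeasurableSpace E] [BorelSpace E] [SecondCountableTopology E]

/-- The exponential Chebyshev inequality under an exponentially tilted measure. -/
theorem setLIntegral_exp_inner_le {X : Ω → E} (hX : AEMeasurable X P) (θ u : E) (c : ℝ) :
    ∫⁻ ω in {ω | c ≤ ⟪u, X ω⟫}, ENNReal.ofReal (Real.exp ⟪θ, X ω⟫) ∂P
      ≤ ENNReal.ofReal (Real.exp (-c)) *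
        ∫⁻ ω, ENNReal.ofReal (Real.exp ⟪θ + u, X ω⟫) ∂P := by
  have hA : NullMeasurableSet {ω | c ≤ ⟪u, X ω⟫} P :=
    nullMeasurableSet_le aemeasurable_const (by fun_prop)
  rw [← lintegral_indicator₀ hA, ← lintegral_const_mul' _ _ ENNReal.ofReal_ne_top]
  refine lintegral_mono fun ω => ?_
  by_cases hω : c ≤ ⟪u, X ω⟫
  · rw [indicator_of_mem (by exact hω), ← ENNReal.ofReal_mul (Real.exp_pos _).le, ← Real.exp_add,
      inner_add_left]
    gcongr
    linarith
  · rw [indicator_of_notMem (by exact hω)]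
    exact zero_le

theorem measure_le_inner_le {X : Ω → E} (hX : AEMeasurable X P) (u : E) (c : ℝ) :
    P {ω | c ≤ ⟪u, X ω⟫} ≤ ENNReal.ofReal (Real.exp (-c)) *
      ∫⁻ ω, ENNReal.ofReal (Real.exp ⟪u, X ω⟫) ∂P := by
  simpa using setLIntegral_exp_inner_le hX 0 u c

end Chernoff

/-! ### Goodness of the rate function and the upper bound -/

section Upper

variable {E : Type*} [NormedAddCommGroup E] [InnerProductSpace ℝ E] [FiniteDimensional ℝ E]
  {Λ : E → EReal}

/-- If `Λ` is finite near the origin, then for every level the complement of some ball is covered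
by finitely many half-spaces on which an affine minorant of the Legendre transform exceeds the
level. -/
theorem exists_finset_lt_of_norm_ge (h0 : (0 : E) ∈ interior (effDomain Λ)) (a : ℝ) :
    ∃ F : Finset E, ∃ R : ℝ, (∀ θ ∈ F, θ ∈ effDomain Λ) ∧
      ∀ y : E, R ≤ ‖y‖ → ∃ θ ∈ F, a < ⟪θ, y⟫ - (Λ θ).toReal := by
  classical
  obtain ⟨F, δ, hδ, hF⟩ := exists_finset_forall_inner_lt (E := E) zero_lt_one
  have hev : ∀ᶠ l : ℝ in 𝓝[>] 0, ∀ u ∈ F, l • u ∈ effDomain Λ := by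
    rw [Filter.eventually_all_finset]
    intro u _
    have hc : Tendsto (fun l : ℝ => l • u) (𝓝[>] 0) (𝓝 (0 : E)) := by
      have : Tendsto (fun l : ℝ => l • u) (𝓝 0) (𝓝 ((0 : ℝ) • u)) :=
        Continuous.tendsto (by fun_prop) 0
      rw [zero_smul] at this
      exact this.mono_left nhdsWithin_le_nhds
    exact hc.eventually (mem_interior_iff_mem_nhds.1 h0)
  obtain ⟨l, hl, hl0⟩ := (hev.and self_mem_nhdsWithin).exists
  obtain ⟨M, hM⟩ := (F.image fun u => (Λ (l • u)).toReal).bddAbove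
  have hM' : ∀ u ∈ F, (Λ (l • u)).toReal ≤ M := fun u hu =>
    hM (Finset.mem_coe.2 (Finset.mem_image_of_mem _ hu))
  -- For `‖y‖` beyond this radius, some `u ∈ F` has `l ⟪u, y⟫ ≥ l δ ‖y‖ ≥ a + M + 1`, while `Λ (l u)
  -- ≤ M`. The `1` keeps `y` nonzero.
  refine ⟨F.image (l • ·), max 1 ((a + M + 1) / (l * δ)), ?_, fun y hy => ?_⟩
  · intro θ hθ
    obtain ⟨u, hu, rfl⟩ := Finset.mem_image.1 hθ
    exact hl u hu
  · have hy1 : 1 ≤ ‖y‖ := (le_max_left _ _).trans hy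
    have hy0 : 0 < ‖y‖ := zero_lt_one.trans_le hy1
    have hy2 := (le_max_right _ _).trans hy
    rw [div_le_iff₀ (by positivity)] at hy2
    obtain ⟨u, hu, hδu⟩ : ∃ u ∈ F, δ ≤ ⟪u, ‖y‖⁻¹ • y⟫ := by
      by_contra! hcon
      have := hF _ hcon
      rw [norm_smul, norm_inv, norm_norm, inv_mul_cancel₀ hy0.ne'] at this
      exact lt_irrefl _ this
    refine ⟨l • u, Finset.mem_image_of_mem _ hu, ?_⟩
    rw [real_inner_smul_right, ← div_eq_inv_mul, le_div_iff₀ hy0] at hδu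
    rw [real_inner_smul_left]
    have := hM' u hu
    have := mul_le_mul_of_nonneg_left hδu hl0.le
    nlinarith

/-- Level sets are closed by semicontinuity, and bounded because finiteness of `Λ` near the origin
makes the transform coercive. -/
theorem isGoodRateFunction_legendre (hbot : ∀ θ, Λ θ ≠ ⊥) (hzero : Λ 0 = 0)
    (h0 : (0 : E) ∈ interior (effDomain Λ)) : IsGoodRateFunction (legendre Λ) where
  nonneg := legendre_nonneg hzero
  lowerSemicontinuous := lowerSemicontinuous_legendre hbot
  isCompact_level η _ := by
    obtain ⟨F, R, hFD, hF⟩ := exists_finset_lt_of_norm_ge h0 η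
    refine (isCompact_closedBall (0 : E) R).of_isClosed_subset
      ((lowerSemicontinuous_legendre hbot).isClosed_preimage _) fun x hx => ?_
    rw [mem_closedBall_zero_iff]
    by_contra! hlt
    obtain ⟨θ, hθF, hθ⟩ := hF x hlt.le
    exact absurd ((legendre_le_iff hbot).1 hx θ (hFD θ hθF)) (not_le.2 hθ)

/-- A closed set on which the Legendre transform exceeds a level is covered by finitely many
half-spaces on which an affine minorant exceeds it. -/
theorem exists_finset_cover (hbot : ∀ θ, Λ θ ≠ ⊥) (h0 : (0 : E) ∈ interior (effDomain Λ))
    {C : Set E} (hC : IsClosed C) {a : ℝ} (ha : ∀ x ∈ C, (a : EReal) < legendre Λ x) :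
    ∃ F : Finset E, (∀ θ ∈ F, θ ∈ effDomain Λ) ∧
      ∀ y ∈ C, ∃ θ ∈ F, a < ⟪θ, y⟫ - (Λ θ).toReal := by
  classical
  obtain ⟨F, R, hFD, hF⟩ := exists_finset_lt_of_norm_ge h0 a
  obtain ⟨G, hG⟩ := ((isCompact_closedBall (0 : E) R).inter_left hC).elim_finite_subcover
    (fun θ : effDomain Λ => {y : E | a < ⟪(θ : E), y⟫ - (Λ θ).toReal})
    (fun θ => isOpen_lt continuous_const (by fun_prop)) (by
      rintro y ⟨hy, -⟩
      obtain ⟨θ, hθ, hlt⟩ := (lt_legendre_iff hbot).1 (ha y hy)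
      exact mem_iUnion.2 ⟨⟨θ, hθ⟩, hlt⟩)
  refine ⟨F ∪ G.image Subtype.val, ?_, fun y hy => ?_⟩
  · intro θ hθ
    rcases Finset.mem_union.1 hθ with hθ | hθ
    · exact hFD θ hθ
    · obtain ⟨θ', -, rfl⟩ := Finset.mem_image.1 hθ
      exact θ'.2
  · rcases le_total R ‖y‖ with hR | hR
    · obtain ⟨θ, hθ, hlt⟩ := hF y hR
      exact ⟨θ, Finset.mem_union_left _ hθ, hlt⟩
    · obtain ⟨θ, hθ, hlt⟩ := mem_iUnion₂.1 (hG ⟨hy, mem_closedBall_zero_iff.2 hR⟩)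
      exact ⟨θ, Finset.mem_union_right _ (Finset.mem_image_of_mem _ hθ), hlt⟩

variable {Ω : Type*} [MeasurableSpace Ω] [MeasurableSpace E] [BorelSpace E] {P : Measure Ω}
  {Z : ℝ≥0 → Ω → E}

/-- The normalised logarithm of a probability is at most `c` when the probability is at most
`exp (t c)`. -/
theorem one_div_mul_log_le {t c : ℝ} (ht : 0 < t) {p : ℝ≥0∞}
    (hp : p ≤ ENNReal.ofReal (Real.exp (t * c))) :
    ((1 / t : ℝ) : EReal) * ENNReal.log p ≤ c := by
  have h1 : ENNReal.log p ≤ ((t * c : ℝ) : EReal) := by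
    rw [← Real.log_exp (t * c), ← ENNReal.log_ofReal_of_pos (Real.exp_pos _)]
    exact ENNReal.log_le_log hp
  calc ((1 / t : ℝ) : EReal) * ENNReal.log p
      ≤ ((1 / t : ℝ) : EReal) * ((t * c : ℝ) : EReal) :=
        mul_le_mul_of_nonneg_left h1 (by exact_mod_cast (one_div_pos.2 ht).le)
    _ = c := by rw [← EReal.coe_mul]; congr 1; field_simp

theorem le_one_div_mul_log {t c : ℝ} (ht : 0 < t) {p : ℝ≥0∞}
    (hp : ENNReal.ofReal (Real.exp (t * c)) ≤ p) :
    (c : EReal) ≤ ((1 / t : ℝ) : EReal) * ENNReal.log p := by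
  have h1 : ((t * c : ℝ) : EReal) ≤ ENNReal.log p := by
    rw [← Real.log_exp (t * c), ← ENNReal.log_ofReal_of_pos (Real.exp_pos _)]
    exact ENNReal.log_le_log hp
  calc (c : EReal) = ((1 / t : ℝ) : EReal) * ((t * c : ℝ) : EReal) := by
        rw [← EReal.coe_mul]; congr 1; field_simp
    _ ≤ ((1 / t : ℝ) : EReal) * ENNReal.log p :=
        mul_le_mul_of_nonneg_left h1 (by exact_mod_cast (one_div_pos.2 ht).le)

/-- The large deviation upper bound for closed sets. -/
theorem limsup_log_measure_le (hZ : ∀ t, AEMeasurable (Z t) P) (hbot : ∀ θ, Λ θ ≠ ⊥)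
    (hΛ : ∀ t : ℝ≥0, 0 < t → ∀ θ, logMGF (Z t) P θ = ((t : ℝ) : EReal) * Λ θ)
    (h0 : (0 : E) ∈ interior (effDomain Λ)) {C : Set E} (hC : IsClosed C) :
    limsup (fun t : ℝ≥0 => ((1 / (t : ℝ) : ℝ) : EReal) *
      ENNReal.log (P {ω | (t : ℝ)⁻¹ • Z t ω ∈ C})) atTop ≤ -(⨅ x ∈ C, legendre Λ x) := by
  by_contra! hlt
  obtain ⟨r, hr1, hr2⟩ := EReal.lt_iff_exists_real_btwn.1 hlt
  -- Each half-space will have probability at most `exp (t s)`; the gap `r - s` absorbs their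
  -- number.
  obtain ⟨s, hs1, hs2⟩ := EReal.lt_iff_exists_real_btwn.1 hr1
  refine absurd hr2 (not_lt.2 ?_)
  have hsr : s < r := EReal.coe_lt_coe_iff.1 hs2
  have hs : ((-s : ℝ) : EReal) < ⨅ x ∈ C, legendre Λ x := by
    rw [EReal.coe_neg]
    exact EReal.neg_lt_comm.1 hs1
  obtain ⟨F, hFD, hF⟩ := exists_finset_cover hbot h0 hC
    (fun x hx => hs.trans_le (iInf₂_le x hx))
  have hcard : ∀ᶠ t : ℝ≥0 in atTop, (F.card : ℝ) ≤ Real.exp (t * (r - s)) := by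
    have : Tendsto (fun t : ℝ≥0 => Real.exp ((t : ℝ) * (r - s))) atTop atTop :=
      Real.tendsto_exp_atTop.comp
        ((NNReal.tendsto_coe_atTop.2 tendsto_id).atTop_mul_const (sub_pos.2 hsr))
    exact this.eventually_ge_atTop _
  refine limsup_le_of_le (by isBoundedDefault) ?_
  filter_upwards [hcard, eventually_gt_atTop 0] with t hct ht
  have ht' : (0 : ℝ) < t := ht
  refine one_div_mul_log_le ht' ?_
  have hhalf : ∀ θ ∈ F, P {ω | t * (-s + (Λ θ).toReal) ≤ ⟪θ, Z t ω⟫}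
      ≤ ENNReal.ofReal (Real.exp (t * s)) := by
    intro θ hθ
    refine (measure_le_inner_le (hZ t) θ _).trans (le_of_eq ?_)
    rw [lintegral_exp_inner_eq_exp_mul hbot hΛ ht (hFD θ hθ),
      ← ENNReal.ofReal_mul (Real.exp_pos _).le, ← Real.exp_add]
    ring_nf
  calc P {ω | (t : ℝ)⁻¹ • Z t ω ∈ C}
      ≤ P (⋃ θ ∈ F, {ω | t * (-s + (Λ θ).toReal) ≤ ⟪θ, Z t ω⟫}) := by
        refine measure_mono fun ω hω => ?_
        obtain ⟨θ, hθ, hlt⟩ := hF _ hω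
        refine mem_iUnion₂.2 ⟨θ, hθ, ?_⟩
        rw [real_inner_smul_right, lt_sub_iff_add_lt, ← div_eq_inv_mul, lt_div_iff₀ ht'] at hlt
        rw [mem_ofPred_eq]
        linarith
    _ ≤ ∑ θ ∈ F, P {ω | t * (-s + (Λ θ).toReal) ≤ ⟪θ, Z t ω⟫} := measure_biUnion_finset_le _ _
    _ ≤ ∑ θ ∈ F, ENNReal.ofReal (Real.exp (t * s)) := Finset.sum_le_sum hhalf
    _ = ENNReal.ofReal (F.card * Real.exp (t * s)) := by
        rw [Finset.sum_const, nsmul_eq_mul, ENNReal.ofReal_mul (by positivity),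
          ENNReal.ofReal_natCast]
    _ ≤ ENNReal.ofReal (Real.exp (t * r)) := by
        refine ENNReal.ofReal_le_ofReal ?_
        calc (F.card : ℝ) * Real.exp (t * s) ≤ Real.exp (t * (r - s)) * Real.exp (t * s) := by
              gcongr
          _ = Real.exp (t * r) := by rw [← Real.exp_add]; ring_nf

end Upper

/-! ### Approximation by gradients through quadratic regularisation -/

section Minimiser

variable {E : Type*} [NormedAddCommGroup E] [InnerProductSpace ℝ E] [FiniteDimensional ℝ E]
  {Λ : E → EReal}

/-- Quadratic regularisation: `Λ - ⟪·, x⟫ + ε / 2 * ‖·‖ ^ 2` attains its minimum. -/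
theorem exists_minimizer_quadratic (hbot : ∀ θ, Λ θ ≠ ⊥) (hlsc : LowerSemicontinuous Λ)
    (hzero : Λ 0 = 0) {x : E} {c : ℝ} (hc : legendre Λ x ≤ c) {ε : ℝ} (hε : 0 < ε) :
    ∃ θ ∈ effDomain Λ, ∀ η ∈ effDomain Λ,
      (Λ θ).toReal + (ε / 2 * ‖θ‖ ^ 2 - ⟪θ, x⟫) ≤ (Λ η).toReal + (ε / 2 * ‖η‖ ^ 2 - ⟪η, x⟫) := by
  set q : E → ℝ := fun θ => ε / 2 * ‖θ‖ ^ 2 - ⟪θ, x⟫ with hq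
  have hqc : Continuous q := by fun_prop
  have h0D : (0 : E) ∈ effDomain Λ := by
    change Λ 0 < ⊤
    rw [hzero]
    exact EReal.zero_lt_top
  have hle : ∀ η ∈ effDomain Λ, ε / 2 * ‖η‖ ^ 2 - c ≤ (Λ η).toReal + q η := fun η hη => by
    have := (legendre_le_iff hbot).1 hc η hη
    simp only [hq]
    linarith
  have hg : LowerSemicontinuous fun θ => Λ θ + (q θ : EReal) :=
    hlsc.add' (continuous_coe_real_ereal.comp hqc).lowerSemicontinuous fun θ =>
      EReal.continuousAt_add (Or.inr (EReal.coe_ne_bot _)) (Or.inr (EReal.coe_ne_top _))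
  -- Outside this ball `ε / 2 * ‖η‖ ^ 2 ≥ c`, so by `hle` the objective is nonnegative there, hence
  -- at least its value `0` at the origin.
  set R : ℝ := max 1 (2 * c / ε) with hR
  have hR0 : 0 ≤ R := zero_le_one.trans (le_max_left _ _)
  obtain ⟨θ, -, hmin⟩ := LowerSemicontinuousOn.exists_isMinOn
    (s := Metric.closedBall (0 : E) R) ⟨0, Metric.mem_closedBall_self hR0⟩
    (isCompact_closedBall 0 R) (hg.lowerSemicontinuousOn _)
  have hθ0 : Λ θ + (q θ : EReal) ≤ 0 := by
    have := isMinOn_iff.1 hmin 0 (Metric.mem_closedBall_self hR0)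
    simpa [hzero, hq] using this
  have hθD : θ ∈ effDomain Λ := by
    change Λ θ < ⊤
    by_contra hcon
    rw [not_lt_top_iff.1 hcon, EReal.top_add_coe] at hθ0
    exact absurd hθ0 (not_le.2 EReal.zero_lt_top)
  rw [← coe_toReal_of_mem_effDomain hbot hθD, ← EReal.coe_add] at hθ0
  refine ⟨θ, hθD, fun η hη => ?_⟩
  by_cases hηR : ‖η‖ ≤ R
  · have := isMinOn_iff.1 hmin η (mem_closedBall_zero_iff.2 hηR)
    rw [← coe_toReal_of_mem_effDomain hbot hθD, ← coe_toReal_of_mem_effDomain hbot hη,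
      ← EReal.coe_add, ← EReal.coe_add] at this
    exact EReal.coe_le_coe_iff.1 this
  · have h1 : (Λ θ).toReal + q θ ≤ 0 := by exact_mod_cast hθ0
    have h2 := hle η hη
    push Not at hηR
    have h3 : 1 ≤ ‖η‖ := (le_max_left _ _).trans hηR.le
    have h4 : 2 * c / ε ≤ ‖η‖ := (le_max_right _ _).trans hηR.le
    rw [div_le_iff₀ hε] at h4
    have h5 : ‖η‖ ≤ ‖η‖ ^ 2 := by nlinarith
    have h6 : c ≤ ε / 2 * ‖η‖ ^ 2 := by nlinarith
    change (Λ θ).toReal + q θ ≤ (Λ η).toReal + q η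
    linarith

/-- Steepness forces the minimiser of the regularised function into the interior of the
effective domain. -/
theorem minimizer_quadratic_mem_interior (hsm : EssentiallySmooth Λ)
    (hconv : ConvexOn ℝ (effDomain Λ) fun θ => (Λ θ).toReal)
    (h0 : (0 : E) ∈ interior (effDomain Λ)) {x θ : E} {ε : ℝ} (hε : 0 < ε)
    (hθ : θ ∈ effDomain Λ) (hmin : ∀ η ∈ effDomain Λ,
      (Λ θ).toReal + (ε / 2 * ‖θ‖ ^ 2 - ⟪θ, x⟫) ≤ (Λ η).toReal + (ε / 2 * ‖η‖ ^ 2 - ⟪η, x⟫)) :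
    θ ∈ interior (effDomain Λ) := by
  -- If `θ` were a boundary point, the gradients `G` along the segment from `0` to `θ` would blow
  -- up. Minimality bounds `⟪G, θ⟫` by `⟪θ, x⟫`, and the gradient inequality towards a small ball
  -- around `0` then bounds `r * ‖G‖`.
  by_contra hcon
  set f : E → ℝ := fun θ => (Λ θ).toReal with hf
  have hcont : ContinuousAt f 0 :=
    hconv.continuousOn_interior.continuousAt (isOpen_interior.mem_nhds h0)
  have hev : ∀ᶠ y in 𝓝 (0 : E), f y < f 0 + 1 ∧ y ∈ effDomain Λ :=
    (hcont.eventually_lt_const (lt_add_one _)).and (mem_interior_iff_mem_nhds.1 h0)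
  obtain ⟨r, hr, hball⟩ := Metric.nhds_basis_closedBall.eventually_iff.1 hev
  let s : ℕ → ℝ := fun n => 1 / ((n : ℝ) + 2)
  have hs0 : ∀ n, 0 < s n := fun n => by positivity
  have hs1 : ∀ n, s n ≤ 1 := fun n => by
    have : (0 : ℝ) ≤ n := n.cast_nonneg
    rw [div_le_one (by positivity)]
    linarith
  let u : ℕ → E := fun n => (1 - s n) • θ
  have hu : ∀ n, u n ∈ interior (effDomain Λ) := fun n => by
    have := hconv.1.combo_interior_closure_mem_interior h0 (subset_closure hθ) (hs0 n)
      (sub_nonneg.2 (hs1 n)) (by ring)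
    simpa [u] using this
  have hslim : Tendsto s atTop (𝓝 0) := by
    have := (tendsto_const_div_atTop_nhds_zero_nat (1 : ℝ)).comp (tendsto_add_atTop_nat 2)
    refine this.congr fun n => ?_
    simp [s]
  have hulim : Tendsto u atTop (𝓝 θ) := by
    have := (hslim.const_sub 1).smul_const θ
    simpa [u] using this
  have hgrad := hsm.steep u θ hu ⟨subset_closure hθ, hcon⟩ hulim
  obtain ⟨n, hn⟩ := (hgrad.eventually_gt_atTop ((f 0 + 1 - f θ + ⟪θ, x⟫) / r)).exists
  set G := gradient (fun η => (Λ η).toReal) (u n) with hG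
  rw [div_lt_iff₀ hr] at hn
  have hGat : HasGradientAt f G (u n) := (hsm.differentiable (u n) (hu n)).hasGradientAt
  have huD : u n ∈ effDomain Λ := interior_subset (hu n)
  -- The point of the ball of radius `r` furthest in the direction of `G`; when `G = 0`, division by
  -- zero gives `w = 0`, which also serves.
  set w : E := (r / ‖G‖) • G with hw
  have hwr : ‖w‖ ≤ r := by
    rw [hw, norm_smul, Real.norm_of_nonneg (by positivity)]
    rcases eq_or_ne ‖G‖ 0 with hG0 | hG0
    · simpa [hG0] using hr.le
    · rw [div_mul_cancel₀ _ hG0]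
  obtain ⟨hwf, hwD⟩ := hball (mem_closedBall_zero_iff.2 hwr)
  have hGw : ⟪G, w⟫ = r * ‖G‖ := by
    rw [hw, real_inner_smul_right, real_inner_self_eq_norm_sq]
    by_cases hG0 : ‖G‖ = 0
    · simp [hG0]
    · field_simp
  have h1 := add_inner_le_of_hasGradientAt hconv huD hwD hGat
  have h2 := add_inner_le_of_hasGradientAt hconv huD hθ hGat
  have h3 := hmin (u n) huD
  have e1 : ⟪G, w - u n⟫ = r * ‖G‖ - (1 - s n) * ⟪G, θ⟫ := by
    rw [inner_sub_right, hGw, real_inner_smul_right]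
  have e2 : ⟪G, θ - u n⟫ = s n * ⟪G, θ⟫ := by
    rw [inner_sub_right, real_inner_smul_right]; ring
  have e3 : ⟪u n, x⟫ = (1 - s n) * ⟪θ, x⟫ := real_inner_smul_left _ _ _
  have e4 : ‖u n‖ ^ 2 = (1 - s n) ^ 2 * ‖θ‖ ^ 2 := by
    rw [norm_smul, mul_pow, Real.norm_eq_abs, sq_abs]
  rw [e1] at h1
  rw [e2] at h2
  rw [e3, e4] at h3
  have hsn := hs0 n
  have hsn' := hs1 n
  change f θ + _ ≤ f (u n) + _ at h3
  -- The quadratic term does not increase from `θ` towards `0`, so it drops out of the comparison.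
  have hq : ε / 2 * ((1 - s n) ^ 2 * ‖θ‖ ^ 2) ≤ ε / 2 * ‖θ‖ ^ 2 := by
    refine mul_le_mul_of_nonneg_left ?_ (by positivity)
    refine mul_le_of_le_one_left (by positivity) ?_
    exact pow_le_one₀ (by linarith) (by linarith)
  have h4 : f θ - f (u n) ≤ s n * ⟪θ, x⟫ := by linarith
  have h5 : ⟪G, θ⟫ ≤ ⟪θ, x⟫ := by
    refine le_of_mul_le_mul_left ?_ hsn
    linarith
  have h6 := mul_le_mul_of_nonneg_left h5 (sub_nonneg.2 hsn')
  linarith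

/-- Points where the Legendre transform is finite are approximated by gradients of an essentially
smooth convex function, with control of the rate. -/
theorem exists_hasGradientAt_sub_smul (hsm : EssentiallySmooth Λ) (hlsc : LowerSemicontinuous Λ)
    (hconv : ConvexOn ℝ (effDomain Λ) fun θ => (Λ θ).toReal) (hzero : Λ 0 = 0)
    (h0 : (0 : E) ∈ interior (effDomain Λ)) {x : E} {c : ℝ} (hc : legendre Λ x ≤ c)
    {ε : ℝ} (hε : 0 < ε) :
    ∃ θ ∈ interior (effDomain Λ), HasGradientAt (fun θ => (Λ θ).toReal) (x - ε • θ) θ ∧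
      ε * ‖θ‖ ^ 2 ≤ 2 * c ∧ -c ≤ (Λ θ).toReal - ⟪θ, x⟫ := by
  obtain ⟨θ, hθ, hmin⟩ := exists_minimizer_quadratic hsm.ne_bot hlsc hzero hc hε
  have hθi := minimizer_quadratic_mem_interior hsm hconv h0 hε hθ hmin
  have hc' : -c ≤ (Λ θ).toReal - ⟪θ, x⟫ := by
    have := (legendre_le_iff hsm.ne_bot).1 hc θ hθ
    linarith
  refine ⟨θ, hθi, ?_, ?_, hc'⟩
  · have hg := (hsm.differentiable θ hθi).hasGradientAt
    set g := gradient (fun η => (Λ η).toReal) θ with hgdef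
    have hd : HasFDerivAt (fun η => (Λ η).toReal + (ε / 2 * ‖η‖ ^ 2 - ⟪x, η⟫))
        (InnerProductSpace.toDual ℝ E g + ((ε / 2) • (2 • innerSL ℝ θ) - innerSL ℝ x)) θ :=
      hg.hasFDerivAt.add (((hasStrictFDerivAt_norm_sq θ).hasFDerivAt.const_mul (ε / 2)).sub
        (innerSL ℝ x).hasFDerivAt)
    have hloc : IsLocalMin (fun η => (Λ η).toReal + (ε / 2 * ‖η‖ ^ 2 - ⟪x, η⟫)) θ := by
      filter_upwards [mem_interior_iff_mem_nhds.1 hθi] with η hη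
      simpa only [real_inner_comm] using hmin η hη
    have hz := hloc.hasFDerivAt_eq_zero hd
    have : g = x - ε • θ := by
      refine ext_inner_right ℝ fun v => ?_
      have := congrArg (fun L => L v) hz
      simp at this
      rw [inner_sub_left, real_inner_smul_left]
      linarith
    rwa [this] at hg
  -- Comparison with the origin: the minimum is at most `0`, while its part without the quadratic
  -- term is at least `-c`.
  · have h1 := hmin 0 (interior_subset h0)
    simp only [hzero, EReal.toReal_zero, norm_zero, inner_zero_left] at h1
    linarith

/-- The slope of `f` at `θ` along `u` is `⟪u, y⟫`. The strict gap `δ` makes half-spaces away from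
`y` exponentially negligible under the tilted law. -/
theorem exists_lt_of_hasGradientAt {f : E → ℝ} {D : Set E} {θ y : E} (hθ : θ ∈ interior D)
    (hg : HasGradientAt f y θ) (u : E) {δ : ℝ} (hδ : 0 < δ) :
    ∃ l > 0, θ + l • u ∈ D ∧ f (θ + l • u) < f θ + l * (δ + ⟪u, y⟫) := by
  have h1 : HasDerivAt (fun s : ℝ => θ + s • u) u 0 := by
    simpa using ((hasDerivAt_id (0 : ℝ)).smul_const u).const_add θ
  have hd : HasDerivAt (fun s : ℝ => f (θ + s • u)) ⟪y, u⟫ 0 := by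
    have h2 : HasFDerivAt f (InnerProductSpace.toDual ℝ E y) (θ + (0 : ℝ) • u) := by
      simpa using hg.hasFDerivAt
    simpa [Function.comp_def] using h2.comp_hasDerivAt (0 : ℝ) h1
  have hD : ∀ᶠ l : ℝ in 𝓝[>] 0, θ + l • u ∈ D := by
    have : Tendsto (fun l : ℝ => θ + l • u) (𝓝 0) (𝓝 θ) := by
      simpa using h1.continuousAt.tendsto
    exact (this.mono_left nhdsWithin_le_nhds).eventually (mem_interior_iff_mem_nhds.1 hθ)
  have hs := hd.tendsto_slope_zero_right.eventually_lt_const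
    (show ⟪y, u⟫ < δ + ⟪u, y⟫ by rw [real_inner_comm]; linarith)
  obtain ⟨l, hl, hlD, hl0⟩ := (hs.and (hD.and self_mem_nhdsWithin)).exists
  have hl0' : 0 < l := hl0
  refine ⟨l, hl0', hlD, ?_⟩
  simp only [zero_add, zero_smul, add_zero, smul_eq_mul] at hl
  rw [inv_mul_lt_iff₀ hl0'] at hl
  linarith

end Minimiser

/-! ### Exponential tilting and the lower bound -/

section Lower

variable {E : Type*} [NormedAddCommGroup E] [InnerProductSpace ℝ E] [FiniteDimensional ℝ E]
  {Λ : E → EReal} {Ω : Type*} [MeasurableSpace Ω] [MeasurableSpace E] [BorelSpace E]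
  {P : Measure Ω} [IsProbabilityMeasure P] {Z : ℝ≥0 → Ω → E}

/-- Exponential tilting: the local lower bound at gradients of `Λ`. -/
theorem eventually_exp_le_measure (hZ : ∀ t, AEMeasurable (Z t) P) (hbot : ∀ θ, Λ θ ≠ ⊥)
    (hΛ : ∀ t : ℝ≥0, 0 < t → ∀ θ, logMGF (Z t) P θ = ((t : ℝ) : EReal) * Λ θ)
    {θ y : E} (hθ : θ ∈ interior (effDomain Λ))
    (hg : HasGradientAt (fun θ => (Λ θ).toReal) y θ) {r η : ℝ} (hr : 0 < r) (hη : 0 < η) :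
    ∀ᶠ t : ℝ≥0 in atTop, ENNReal.ofReal (Real.exp (t * ((Λ θ).toReal - ⟪θ, y⟫ - η)))
      ≤ P {ω | ‖(t : ℝ)⁻¹ • Z t ω - y‖ < r} := by
  have hθD := interior_subset hθ
  -- Within distance `r'` of `y`, the functional `⟪θ, ·⟫` varies by at most `η / 2`; the other `η /
  -- 2` pays for a factor `2`.
  set r' : ℝ := min r (η / 2 / (‖θ‖ + 1)) with hr'
  have hr'0 : 0 < r' := lt_min hr (by positivity)
  obtain ⟨F, δ, hδ, hF⟩ := exists_finset_forall_inner_lt (E := E) hr'0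
  choose l hl0 hlD hl using fun u => exists_lt_of_hasGradientAt hθ hg u hδ
  -- The exponential rate at which the half-space of `u` loses its share of the tilted mass.
  set ρ : E → ℝ := fun u =>
    (Λ θ).toReal + l u * (δ + ⟪u, y⟫) - (Λ (θ + l u • u)).toReal with hρ
  have hρ0 : ∀ u, 0 < ρ u := fun u => sub_pos.2 (hl u)
  have hcoe : Tendsto (fun t : ℝ≥0 => (t : ℝ)) atTop atTop := NNReal.tendsto_coe_atTop.2 tendsto_id
  have hsum : ∀ᶠ t : ℝ≥0 in atTop, ∑ u ∈ F, Real.exp (-(t * ρ u)) < 1 / 2 := by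
    have : Tendsto (fun t : ℝ≥0 => ∑ u ∈ F, Real.exp (-((t : ℝ) * ρ u))) atTop
        (𝓝 (∑ _u ∈ F, (0 : ℝ))) :=
      tendsto_finsetSum _ fun u _ => Real.tendsto_exp_neg_atTop_nhds_zero.comp
        (hcoe.atTop_mul_const (hρ0 u))
    rw [Finset.sum_const_zero] at this
    exact this.eventually_lt_const (by norm_num)
  have hexp : ∀ᶠ t : ℝ≥0 in atTop, 2 ≤ Real.exp (t * (η / 2)) :=
    (Real.tendsto_exp_atTop.comp (hcoe.atTop_mul_const (half_pos hη))).eventually_ge_atTop 2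
  filter_upwards [hsum, hexp, eventually_gt_atTop 0] with t hsum hexp ht
  have ht' : (0 : ℝ) < t := ht
  -- The tilt is left unnormalised, with total mass `exp (t Λ(θ))`. For large `t` the half-spaces `B
  -- u` carry less than half of it, so `A` keeps the rest.
  set w : Ω → ℝ≥0∞ := fun ω => ENNReal.ofReal (Real.exp ⟪θ, Z t ω⟫) with hw
  set Q := P.withDensity w with hQ
  set A : Set Ω := {ω | ‖(t : ℝ)⁻¹ • Z t ω - y‖ < r'} with hA
  set B : E → Set Ω := fun u => {ω | l u * (t * (δ + ⟪u, y⟫)) ≤ ⟪l u • u, Z t ω⟫} with hB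
  have hcover : (univ : Set Ω) ⊆ A ∪ ⋃ u ∈ F, B u := by
    intro ω _
    by_cases hω : ω ∈ A
    · exact Or.inl hω
    · right
      by_contra hcon
      refine hω (hF _ fun u hu => ?_)
      by_contra! hle
      refine hcon (mem_iUnion₂.2 ⟨u, hu, ?_⟩)
      rw [inner_sub_right, real_inner_smul_right, le_sub_iff_add_le, ← div_eq_inv_mul,
        le_div_iff₀ ht', mul_comm] at hle
      rw [hB, mem_ofPred_eq, real_inner_smul_left]
      exact mul_le_mul_of_nonneg_left hle (hl0 u).le
  have hQuniv : Q univ = ENNReal.ofReal (Real.exp (t * (Λ θ).toReal)) := by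
    rw [hQ, withDensity_apply', setLIntegral_univ]
    exact lintegral_exp_inner_eq_exp_mul hbot hΛ ht hθD
  have hQB : ∀ u ∈ F, Q (B u)
      ≤ ENNReal.ofReal (Real.exp (t * (Λ θ).toReal) * Real.exp (-(t * ρ u))) := by
    intro u _
    rw [hQ, withDensity_apply']
    refine (setLIntegral_exp_inner_le (hZ t) θ (l u • u) _).trans (le_of_eq ?_)
    rw [lintegral_exp_inner_eq_exp_mul hbot hΛ ht (hlD u),
      ← ENNReal.ofReal_mul (Real.exp_pos _).le, ← Real.exp_add, ← Real.exp_add]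
    simp only [hρ]
    ring_nf
  have hAmeas : NullMeasurableSet A P :=
    nullMeasurableSet_lt (by fun_prop) aemeasurable_const
  have hQA : Q A ≤ ENNReal.ofReal (Real.exp (t * (⟪θ, y⟫ + η / 2)) * P.real A) := by
    rw [hQ, withDensity_apply', ENNReal.ofReal_mul (Real.exp_pos _).le, ofReal_measureReal,
      ← setLIntegral_const]
    refine lintegral_mono_ae ((ae_restrict_iff'₀ hAmeas).2 (Eventually.of_forall fun ω hω => ?_))
    refine ENNReal.ofReal_le_ofReal (Real.exp_le_exp.2 ?_)
    have h1 : ⟪θ, (t : ℝ)⁻¹ • Z t ω - y⟫ ≤ η / 2 := by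
      have hω' : ‖(t : ℝ)⁻¹ • Z t ω - y‖ ≤ η / 2 / (‖θ‖ + 1) :=
        (le_of_lt hω).trans (min_le_right _ _)
      rw [le_div_iff₀ (by positivity)] at hω'
      have := real_inner_le_norm θ ((t : ℝ)⁻¹ • Z t ω - y)
      nlinarith [norm_nonneg ((t : ℝ)⁻¹ • Z t ω - y)]
    rw [inner_sub_right, real_inner_smul_right, sub_le_iff_le_add, ← div_eq_inv_mul,
      div_le_iff₀ ht'] at h1
    linarith
  have htotal : Real.exp (t * (Λ θ).toReal) ≤ Real.exp (t * (⟪θ, y⟫ + η / 2)) * P.real A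
      + ∑ u ∈ F, Real.exp (t * (Λ θ).toReal) * Real.exp (-(t * ρ u)) := by
    rw [← ENNReal.ofReal_le_ofReal_iff (by positivity), ← hQuniv,
      ENNReal.ofReal_add (by positivity) (by positivity),
      ENNReal.ofReal_sum_of_nonneg (fun _ _ => by positivity)]
    calc Q univ ≤ Q (A ∪ ⋃ u ∈ F, B u) := measure_mono hcover
      _ ≤ Q A + Q (⋃ u ∈ F, B u) := measure_union_le _ _
      _ ≤ Q A + ∑ u ∈ F, Q (B u) := by gcongr; exact measure_biUnion_finset_le _ _
      _ ≤ _ := add_le_add hQA (Finset.sum_le_sum hQB)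
  rw [← Finset.mul_sum] at htotal
  have hhalf : Real.exp (t * (Λ θ).toReal) / 2
      ≤ Real.exp (t * (⟪θ, y⟫ + η / 2)) * P.real A := by
    have := mul_le_mul_of_nonneg_left hsum.le (Real.exp_pos (t * (Λ θ).toReal)).le
    linarith
  have hA' : Real.exp (t * ((Λ θ).toReal - ⟪θ, y⟫ - η)) ≤ P.real A := by
    have e : Real.exp (t * ((Λ θ).toReal - ⟪θ, y⟫ - η)) * Real.exp (t * (⟪θ, y⟫ + η / 2))
        * Real.exp (t * (η / 2)) = Real.exp (t * (Λ θ).toReal) := by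
      rw [← Real.exp_add, ← Real.exp_add]
      ring_nf
    refine le_of_mul_le_mul_right ?_ (Real.exp_pos (t * (⟪θ, y⟫ + η / 2)))
    have := mul_le_mul_of_nonneg_left hexp
      (show 0 ≤ Real.exp (t * ((Λ θ).toReal - ⟪θ, y⟫ - η)) * Real.exp (t * (⟪θ, y⟫ + η / 2))
        by positivity)
    linarith
  calc ENNReal.ofReal (Real.exp (t * ((Λ θ).toReal - ⟪θ, y⟫ - η)))
      ≤ ENNReal.ofReal (P.real A) := ENNReal.ofReal_le_ofReal hA'
    _ = P A := ofReal_measureReal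
    _ ≤ _ := measure_mono fun ω (hω : _ < r') => hω.trans_le (min_le_left _ _)

/-- The large deviation lower bound for open sets. -/
theorem le_liminf_log_measure (hZ : ∀ t, AEMeasurable (Z t) P) (hsm : EssentiallySmooth Λ)
    (hlsc : LowerSemicontinuous Λ) (hconv : ConvexOn ℝ (effDomain Λ) fun θ => (Λ θ).toReal)
    (hΛ : ∀ t : ℝ≥0, 0 < t → ∀ θ, logMGF (Z t) P θ = ((t : ℝ) : EReal) * Λ θ)
    (hzero : Λ 0 = 0) (h0 : (0 : E) ∈ interior (effDomain Λ)) {O : Set E} (hO : IsOpen O) :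
    -(⨅ x ∈ O, legendre Λ x) ≤ liminf (fun t : ℝ≥0 => ((1 / (t : ℝ) : ℝ) : EReal) *
      ENNReal.log (P {ω | (t : ℝ)⁻¹ • Z t ω ∈ O})) atTop := by
  by_contra! hlt
  obtain ⟨r, hr1, hr2⟩ := EReal.lt_iff_exists_real_btwn.1 hlt
  refine absurd hr1 (not_lt.2 ?_)
  have hI : ⨅ x ∈ O, legendre Λ x < ((-r : ℝ) : EReal) := by
    rw [EReal.coe_neg]
    exact EReal.lt_neg_comm.1 hr2
  simp only [iInf_lt_iff] at hI
  obtain ⟨x, hxO, hx⟩ := hI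
  obtain ⟨c, hc1, hc2⟩ := EReal.lt_iff_exists_real_btwn.1 hx
  have hcr : c < -r := EReal.coe_lt_coe_iff.1 hc2
  have hc0 : 0 ≤ c := by
    exact_mod_cast (legendre_nonneg hzero x).trans hc1.le
  obtain ⟨d, hd, hball⟩ := Metric.isOpen_iff.1 hO x hxO
  -- Then `‖ε θ‖² ≤ 2 c ε ≤ (d / 2)²`; the `+ 1` covers `c = 0`.
  set ε : ℝ := (d / 2) ^ 2 / (2 * c + 1) with hε
  have hε0 : 0 < ε := by positivity
  obtain ⟨θ, hθ, hg, hnorm, hval⟩ :=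
    exists_hasGradientAt_sub_smul hsm hlsc hconv hzero h0 hc1.le hε0
  have hdist : ‖ε • θ‖ ≤ d / 2 := by
    rw [norm_smul, Real.norm_of_nonneg hε0.le]
    refine le_of_sq_le_sq ?_ (by positivity)
    have h1 : ε * (2 * c + 1) = (d / 2) ^ 2 := by rw [hε]; field_simp
    have h2 := mul_le_mul_of_nonneg_left hnorm hε0.le
    nlinarith
  have hinner : -c ≤ (Λ θ).toReal - ⟪θ, x - ε • θ⟫ := by
    rw [inner_sub_right, real_inner_smul_right, real_inner_self_eq_norm_sq]
    have : 0 ≤ ε * ‖θ‖ ^ 2 := by positivity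
    linarith
  have hev := eventually_exp_le_measure hZ hsm.ne_bot hΛ hθ hg (half_pos hd)
    (show 0 < -r - c by linarith)
  refine le_liminf_of_le (by isBoundedDefault) ?_
  filter_upwards [hev, eventually_gt_atTop 0] with t htP ht
  have ht' : (0 : ℝ) < t := ht
  refine le_one_div_mul_log ht' ?_
  calc ENNReal.ofReal (Real.exp (t * r))
      ≤ ENNReal.ofReal (Real.exp (t * ((Λ θ).toReal - ⟪θ, x - ε • θ⟫ - (-r - c)))) := by
        gcongr
        linarith
    _ ≤ _ := htP
    _ ≤ _ := by
        refine measure_mono fun ω hω => hball ?_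
        rw [mem_ball_iff_norm]
        have hω' : ‖(t : ℝ)⁻¹ • Z t ω - (x - ε • θ)‖ < d / 2 := hω
        have e : (t : ℝ)⁻¹ • Z t ω - x = ((t : ℝ)⁻¹ • Z t ω - (x - ε • θ)) - ε • θ := by abel
        rw [e]
        refine (norm_sub_le _ _).trans_lt ?_
        linarith

end Lower

/-! ### Right-sided grids, the functional equation and random times -/

section Discretisation

/-- The first point of the grid `(n + 1)⁻¹ ℕ` strictly to the right of `t`. -/
noncomputable def gridRight (n : ℕ) (t : ℝ≥0) : ℝ≥0 := (⌊((n : ℝ≥0) + 1) * t⌋₊ + 1) / ((n : ℝ≥0) + 1)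

theorem le_gridRight (n : ℕ) (t : ℝ≥0) : t ≤ gridRight n t := by
  rw [gridRight, le_div_iff₀ (by positivity), mul_comm]
  exact (Nat.lt_floor_add_one _).le

theorem gridRight_le (n : ℕ) (t : ℝ≥0) : gridRight n t ≤ t + 1 / ((n : ℝ≥0) + 1) := by
  rw [gridRight, add_div]
  gcongr
  rw [div_le_iff₀ (by positivity), mul_comm t]
  exact Nat.floor_le (zero_le)

theorem tendsto_gridRight (t : ℝ≥0) : Tendsto (fun n => gridRight n t) atTop (𝓝 t) := by
  have h : Tendsto (fun n : ℕ => t + 1 / ((n : ℝ≥0) + 1)) atTop (𝓝 t) := by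
    simpa using (tendsto_one_div_add_atTop_nhds_zero_nat (𝕜 := ℝ≥0)).const_add t
  exact tendsto_of_tendsto_of_tendsto_of_le_of_le tendsto_const_nhds h
    (fun n => le_gridRight n t) fun n => gridRight_le n t

theorem tendsto_gridRight_of_continuousWithinAt {E : Type*} [TopologicalSpace E] {x : ℝ≥0 → E}
    {t : ℝ≥0} (hx : ContinuousWithinAt x (Ici t) t) :
    Tendsto (fun n => x (gridRight n t)) atTop (𝓝 (x t)) :=
  hx.tendsto.comp (tendsto_nhdsWithin_iff.2
    ⟨tendsto_gridRight t, Eventually.of_forall fun n => le_gridRight n t⟩)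

/-- Evaluating a path on a grid is jointly measurable in the path and the time. -/
theorem measurable_eval_gridRight {E : Type*} [MeasurableSpace E] (n : ℕ) :
    Measurable fun p : (ℝ≥0 → E) × ℝ≥0 => p.1 (gridRight n p.2) := by
  -- Once rounded, time takes countably many values, and each gives a coordinate projection.
  have h1 : Measurable fun q : (ℝ≥0 → E) × ℕ => q.1 ((q.2 + 1) / ((n : ℝ≥0) + 1)) :=
    measurable_from_prod_countable_left fun k =>
      measurable_pi_apply (((k : ℝ≥0) + 1) / ((n : ℝ≥0) + 1))
  have h2 : Measurable fun p : (ℝ≥0 → E) × ℝ≥0 => (p.1, ⌊((n : ℝ≥0) + 1) * p.2⌋₊) :=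
    measurable_fst.prodMk (Nat.measurable_floor.comp (measurable_snd.const_mul _))
  exact h1.comp h2

end Discretisation

/-- A positive multiplicative function on `[0, ∞)` that is lower semicontinuous from the right is
a power function. -/
theorem eq_rpow_of_map_add {φ : ℝ≥0 → ℝ≥0∞} (h0 : φ 0 = 1) (hadd : ∀ s t, φ (s + t) = φ s * φ t)
    (hne : ∀ t, φ t ≠ 0) (hlsc : ∀ t, φ t ≤ liminf (fun n => φ (gridRight n t)) atTop) (t : ℝ≥0) :
    φ t = φ 1 ^ (t : ℝ) := by
  have hmul : ∀ (n : ℕ) (s : ℝ≥0), φ (n * s) = φ s ^ n := by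
    intro n s
    induction n with
    | zero => simp [h0]
    | succ k ih => rw [Nat.cast_succ, add_mul, one_mul, hadd, ih, pow_succ]
  -- If `φ 1 = ⊤` and `n t ≥ 1`, then `φ t ^ n = φ 1 * φ (n t - 1) = ⊤`.
  rcases eq_or_ne (φ 1) ⊤ with htop | htop
  · rcases eq_or_ne t 0 with rfl | ht
    · simp [h0]
    · have ht0 : 0 < t := pos_iff_ne_zero.2 ht
      rw [htop, ENNReal.top_rpow_of_pos (by exact_mod_cast ht0)]
      obtain ⟨n, hn⟩ := Archimedean.arch 1 ht0
      rw [nsmul_eq_mul] at hn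
      have h1 : φ t ^ n = ⊤ := by
        rw [← hmul, ← add_tsub_cancel_of_le hn, hadd, htop, ENNReal.top_mul (hne _)]
      exact ((ENNReal.pow_eq_top_iff).1 h1).1
  · have hrat : ∀ k m : ℕ, φ ((k : ℝ≥0) / ((m : ℝ≥0) + 1)) =
        φ 1 ^ (((k : ℝ≥0) / ((m : ℝ≥0) + 1) : ℝ≥0) : ℝ) := by
      intro k m
      have h1 : φ ((k : ℝ≥0) / ((m : ℝ≥0) + 1)) ^ (m + 1) = φ 1 ^ k := by
        rw [← hmul, ← hmul]
        congr 1
        push_cast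
        field_simp
      have hm : ((m : ℝ) + 1) ≠ 0 := by positivity
      rw [← ENNReal.rpow_natCast, ← ENNReal.rpow_natCast] at h1
      have h2 := congrArg (fun a => a ^ ((m : ℝ) + 1)⁻¹) h1
      simp only [← ENNReal.rpow_mul] at h2
      push_cast at h2 ⊢
      rwa [mul_inv_cancel₀ hm, ENNReal.rpow_one, ← div_eq_mul_inv] at h2
    have hle : ∀ s : ℝ≥0, φ s ≤ φ 1 ^ (s : ℝ) := by
      intro s
      refine (hlsc s).trans (le_of_eq (Tendsto.liminf_eq ?_))
      have hc : Continuous fun a : ℝ => φ 1 ^ a := by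
        have : ∀ a : ℝ, φ 1 ^ a = ENNReal.ofReal ((φ 1).toReal ^ a) := fun a => by
          rw [← ENNReal.ofReal_rpow_of_pos (ENNReal.toReal_pos (hne 1) htop),
            ENNReal.ofReal_toReal htop]
        simp_rw [this]
        exact ENNReal.continuous_ofReal.comp
          (Real.continuous_const_rpow (ENNReal.toReal_pos (hne 1) htop).ne')
      have := (hc.tendsto (s : ℝ)).comp (NNReal.tendsto_coe.2 (tendsto_gridRight s))
      refine this.congr fun n => ?_
      have := hrat (⌊((n : ℝ≥0) + 1) * s⌋₊ + 1) n
      simp only [Nat.cast_add, Nat.cast_one] at this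
      exact this.symm
    -- Semicontinuity yields only `≤`. At `t` and at `n - t` the two bounds multiply to the exact
    -- value `φ 1 ^ n`, so neither can be strict.
    refine le_antisymm (hle t) ?_
    obtain ⟨n, hn⟩ := exists_nat_ge t
    have hsum : t + ((n : ℝ≥0) - t) = n := add_tsub_cancel_of_le hn
    have h1 : φ t * φ (n - t) = φ 1 ^ (t : ℝ) * φ 1 ^ (((n : ℝ≥0) - t : ℝ≥0) : ℝ) := by
      rw [← hadd, ← ENNReal.rpow_add _ _ (hne 1) htop, ← NNReal.coe_add, hsum]
      have := hmul n 1
      rw [mul_one] at this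
      rw [this, NNReal.coe_natCast, ENNReal.rpow_natCast]
    refine (ENNReal.mul_le_mul_iff_left (c := φ 1 ^ (((n : ℝ≥0) - t : ℝ≥0) : ℝ)) ?_ ?_).1 ?_
    · exact (ENNReal.rpow_pos (pos_iff_ne_zero.2 (hne 1)) htop).ne'
    · exact ENNReal.rpow_ne_top_of_nonneg (NNReal.coe_nonneg _) htop
    · rw [← h1]
      gcongr
      exact hle _

/-- A Lévy process at a random time is a random variable. -/
theorem IsLevyProcess.aemeasurable_comp {Ω E : Type*} [MeasurableSpace Ω]
    [NormedAddCommGroup E] [MeasurableSpace E] [BorelSpace E] {P : Measure Ω} {X : ℝ≥0 → Ω → E}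
    (hX : IsLevyProcess X P) {τ : Ω → ℝ≥0}
    (hτ : Measurable τ) : AEMeasurable (fun ω => X (τ ω) ω) P := by
  refine aemeasurable_of_tendsto_metrizable_ae atTop (f := fun n ω => X (gridRight n (τ ω)) ω)
    (fun n => ?_) ?_
  · exact ((measurable_eval_gridRight n).comp
      ((measurable_pi_lambda _ hX.measurable).prodMk hτ)).aemeasurable
  · filter_upwards [hX.cadlag] with ω hω
    exact tendsto_gridRight_of_continuousWithinAt (hω.1 (τ ω))

theorem IsSubordinator.nonneg {Ω : Type*} [MeasurableSpace Ω] {P : Measure Ω}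
    {V : ℝ≥0 → Ω → ℝ} (hV : IsSubordinator V P) : ∀ᵐ ω ∂P, ∀ t, 0 ≤ V t ω := by
  filter_upwards [hV.levy.start_zero, hV.monotone] with ω h0 hmono t
  have := hmono (zero_le : 0 ≤ t)
  simpa [h0] using this

/-! ### Moment generating functions of Lévy processes -/

section Levy

variable {Ω E : Type*} [MeasurableSpace Ω] [NormedAddCommGroup E] [InnerProductSpace ℝ E]
  [MeasurableSpace E] [BorelSpace E] [SecondCountableTopology E] {P : Measure Ω}
  {X : ℝ≥0 → Ω → E}

/-- The increment `X (s + t) - X s` is independent of `X s` and, as `X 0 = 0` almost surely, has the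
law of `X t`. In `[0, ∞]` no integrability is required. -/
theorem IsLevyProcess.lintegral_exp_inner_add (hX : IsLevyProcess X P) (θ : E) (s t : ℝ≥0) :
    ∫⁻ ω, ENNReal.ofReal (Real.exp ⟪θ, X (s + t) ω⟫) ∂P =
      (∫⁻ ω, ENNReal.ofReal (Real.exp ⟪θ, X s ω⟫) ∂P) *
        ∫⁻ ω, ENNReal.ofReal (Real.exp ⟪θ, X t ω⟫) ∂P := by
  have hg : Measurable fun x : E => ENNReal.ofReal (Real.exp ⟪θ, x⟫) := by fun_prop
  have hms := hX.measurable s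
  have hmst := hX.measurable (s + t)
  have hind : IndepFun (X s) (X (s + t) - X s) P :=
    hX.indep_increments.indepFun_eval_sub (zero_le) le_self_add hX.start_zero
  have h1 : ∫⁻ ω, ENNReal.ofReal (Real.exp ⟪θ, X t ω⟫) ∂P =
      ∫⁻ ω, ENNReal.ofReal (Real.exp ⟪θ, (X (s + t) - X s) ω⟫) ∂P := by
    have h2 := ((hX.stationary_increments s t).comp hg).lintegral_eq
    refine Eq.trans (lintegral_congr_ae ?_) h2.symm
    filter_upwards [hX.start_zero] with ω hω
    simp [hω]
  rw [h1]
  refine Eq.trans (lintegral_congr fun ω => ?_)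
    (lintegral_mul_eq_lintegral_mul_lintegral_of_indepFun (hg.comp hms)
      (hg.comp (hmst.sub hms)) (hind.comp hg hg))
  simp only [Pi.mul_apply, Pi.sub_apply]
  rw [← ENNReal.ofReal_mul (Real.exp_pos _).le, ← Real.exp_add, ← inner_add_right,
    add_sub_cancel]

variable [IsProbabilityMeasure P]

theorem lintegral_exp_inner_ne_zero {Y : Ω → E} (hY : Measurable Y) (θ : E) :
    ∫⁻ ω, ENNReal.ofReal (Real.exp ⟪θ, Y ω⟫) ∂P ≠ 0 := fun h =>
  logMGF_ne_bot Y P hY θ (ENNReal.log_eq_bot_iff.2 h)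

/-- The moment generating function of a Lévy process at time `t` is the `t`-th power of the one at
time `1`. -/
theorem IsLevyProcess.lintegral_exp_inner (hX : IsLevyProcess X P) (θ : E) (t : ℝ≥0) :
    ∫⁻ ω, ENNReal.ofReal (Real.exp ⟪θ, X t ω⟫) ∂P =
      (∫⁻ ω, ENNReal.ofReal (Real.exp ⟪θ, X 1 ω⟫) ∂P) ^ (t : ℝ) := by
  refine eq_rpow_of_map_add (φ := fun t => ∫⁻ ω, ENNReal.ofReal (Real.exp ⟪θ, X t ω⟫) ∂P) ?_
    (hX.lintegral_exp_inner_add θ) (fun s => lintegral_exp_inner_ne_zero (hX.measurable s) θ)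
    (fun s => ?_) t
  · rw [lintegral_congr_ae (g := fun _ => 1)]
    · simp
    · filter_upwards [hX.start_zero] with ω hω
      simp [hω]
  · have hm := fun n => hX.measurable (gridRight n s)
    -- Right-continuity of paths and Fatou give lower semicontinuity from the right.
    refine le_trans (le_of_eq (lintegral_congr_ae ?_))
      (lintegral_liminf_le fun n => by have := hm n; fun_prop)
    filter_upwards [hX.cadlag] with ω hω
    have hc : Continuous fun x : E => ENNReal.ofReal (Real.exp ⟪θ, x⟫) :=
      ENNReal.continuous_ofReal.comp (by fun_prop)
    exact ((hc.tendsto _).comp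
      (tendsto_gridRight_of_continuousWithinAt (hω.1 s))).liminf_eq.symm

theorem IsLevyProcess.logMGF_eq (hX : IsLevyProcess X P) (θ : E) (t : ℝ≥0) :
    logMGF (X t) P θ = ((t : ℝ) : EReal) * logMGF (X 1) P θ := by
  rw [logMGF, hX.lintegral_exp_inner θ t, ENNReal.log_rpow, logMGF]

/-- The moment generating function of a Lévy process at an independent random time. -/
theorem IsLevyProcess.lintegral_exp_inner_comp (hX : IsLevyProcess X P) {τ : Ω → ℝ≥0}
    (hτ : Measurable τ) (hind : IndepFun (fun ω t => X t ω) τ P) (θ : E) :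
    ∫⁻ ω, ENNReal.ofReal (Real.exp ⟪θ, X (τ ω) ω⟫) ∂P =
      ∫⁻ ω, (∫⁻ ω', ENNReal.ofReal (Real.exp ⟪θ, X 1 ω'⟫) ∂P) ^ (τ ω : ℝ) ∂P := by
  -- Evaluation of a path at a time need not be jointly measurable; this liminf along the grid is,
  -- and it agrees with evaluation on càdlàg paths, so Tonelli applies.
  let G : (ℝ≥0 → E) × ℝ≥0 → ℝ≥0∞ := fun p =>
    liminf (fun n => ENNReal.ofReal (Real.exp ⟪θ, p.1 (gridRight n p.2)⟫)) atTop
  have hG : Measurable G := Measurable.liminf fun n => by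
    have := measurable_eval_gridRight (E := E) n
    fun_prop
  have hXm : Measurable fun ω t => X t ω := measurable_pi_lambda _ hX.measurable
  have hc : Continuous fun x : E => ENNReal.ofReal (Real.exp ⟪θ, x⟫) :=
    ENNReal.continuous_ofReal.comp (by fun_prop)
  have hGeq : ∀ᵐ ω ∂P, ∀ s : ℝ≥0,
      G (fun t => X t ω, s) = ENNReal.ofReal (Real.exp ⟪θ, X s ω⟫) := by
    filter_upwards [hX.cadlag] with ω hω s
    exact ((hc.tendsto _).comp (tendsto_gridRight_of_continuousWithinAt (hω.1 s))).liminf_eq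
  calc ∫⁻ ω, ENNReal.ofReal (Real.exp ⟪θ, X (τ ω) ω⟫) ∂P
      = ∫⁻ ω, G (fun t => X t ω, τ ω) ∂P := by
        refine lintegral_congr_ae ?_
        filter_upwards [hGeq] with ω hω using (hω _).symm
    _ = ∫⁻ p, G p ∂(P.map fun ω => (fun t => X t ω, τ ω)) :=
        (lintegral_map hG (hXm.prodMk hτ)).symm
    _ = ∫⁻ p, G p ∂((P.map fun ω t => X t ω).prod (P.map τ)) := by
        rw [(indepFun_iff_map_prod_eq_prod_map_map hXm.aemeasurable hτ.aemeasurable).1 hind]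
    _ = ∫⁻ s, ∫⁻ x, G (x, s) ∂(P.map fun ω t => X t ω) ∂(P.map τ) := by
        have := Measure.isProbabilityMeasure_map (μ := P) hXm.aemeasurable
        have := Measure.isProbabilityMeasure_map (μ := P) hτ.aemeasurable
        exact lintegral_prod_symm _ hG.aemeasurable
    _ = ∫⁻ s, (∫⁻ ω', ENNReal.ofReal (Real.exp ⟪θ, X 1 ω'⟫) ∂P) ^ (s : ℝ) ∂(P.map τ) := by
        refine lintegral_congr fun s => ?_
        rw [lintegral_map (by fun_prop) hXm, ← hX.lintegral_exp_inner θ s]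
        refine lintegral_congr_ae ?_
        filter_upwards [hGeq] with ω hω using hω s
    _ = _ := lintegral_map (by fun_prop) hτ

end Levy

/-- A subordinator whose log moment generating function has nonzero derivative at the origin is
not almost surely zero at positive times. -/
theorem IsSubordinator.not_ae_eq_zero {Ω : Type*} [MeasurableSpace Ω] {P : Measure Ω}
    [IsProbabilityMeasure P] {V : ℝ≥0 → Ω → ℝ} (hV : IsSubordinator V P)
    (hpos : 0 < deriv (fun η : ℝ => (logMGF (V 1) P η).toReal) 0) {t : ℝ≥0} (ht : 0 < t) :
    ¬ ∀ᵐ ω ∂P, (V t ω).toNNReal = 0 := by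
  intro h
  refine hpos.ne' ?_
  have hzero : ∀ η : ℝ, logMGF (V 1) P η = 0 := by
    intro η
    have h1 : logMGF (V t) P η = 0 := by
      rw [logMGF, lintegral_congr_ae (g := fun _ => 1)]
      · simp
      · filter_upwards [h, hV.nonneg] with ω hω hnn
        have : V t ω = 0 := le_antisymm (Real.toNNReal_eq_zero.1 hω) (hnn t)
        simp [this]
    rw [hV.levy.logMGF_eq η t, mul_eq_zero] at h1
    refine h1.resolve_left ?_
    have : (t : ℝ) ≠ 0 := by exact_mod_cast ht.ne'
    exact_mod_cast this
  simp [hzero]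

/-! ### The subordinated process -/

section Subordination

variable {Ω E : Type*} [MeasurableSpace Ω] [NormedAddCommGroup E] [InnerProductSpace ℝ E]
  [MeasurableSpace E] [BorelSpace E] [SecondCountableTopology E] {P : Measure Ω}
  [IsProbabilityMeasure P] {S : ℝ≥0 → Ω → E} {V : ℝ≥0 → Ω → ℝ}

/-- The log moment generating function of a subordinated Lévy process. -/
theorem logMGF_subordinated (hS : IsLevyProcess S P) (hV : IsSubordinator V P)
    (hpos : 0 < deriv (fun η : ℝ => (logMGF (V 1) P η).toReal) 0)
    (hSV : IndepFun (fun ω t => S t ω) (fun ω t => V t ω) P) {t : ℝ≥0} (ht : 0 < t) (θ : E) :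
    logMGF (fun ω => S (V t ω).toNNReal ω) P θ =
      ((t : ℝ) : EReal) * compTop (logMGF (V 1) P) (logMGF (S 1) P) θ := by
  have hτ : Measurable fun ω => (V t ω).toNNReal := (hV.levy.measurable t).real_toNNReal
  have hind : IndepFun (fun ω t => S t ω) (fun ω => (V t ω).toNNReal) P :=
    hSV.comp measurable_id
      (show Measurable fun v : ℝ≥0 → ℝ => (v t).toNNReal from
        (measurable_pi_apply t).real_toNNReal)
  unfold compTop
  split_ifs with htop
  · have htop' : ∫⁻ ω, ENNReal.ofReal (Real.exp ⟪θ, S 1 ω⟫) ∂P = ⊤ :=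
      ENNReal.log_eq_top_iff.1 htop
    rw [EReal.coe_mul_top_of_pos (by exact_mod_cast ht), logMGF,
      hS.lintegral_exp_inner_comp hτ hind θ, htop', ENNReal.log_eq_top_iff]
    -- A finite expectation of `⊤ ^ V(t)` would force `V(t) = 0` almost surely.
    by_contra hcon
    refine hV.not_ae_eq_zero hpos ht ?_
    filter_upwards [ae_lt_top (by fun_prop) hcon] with ω hω
    by_contra hne
    rw [ENNReal.top_rpow_of_pos (by exact_mod_cast pos_iff_ne_zero.2 hne)] at hω
    exact lt_irrefl _ hω
  · have hbot := logMGF_ne_bot (S 1) P (hS.measurable 1) θ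
    set κ := (logMGF (S 1) P θ).toReal with hκ
    have hexp := lintegral_exp_inner_eq (EReal.coe_toReal htop hbot).symm
    rw [← hV.levy.logMGF_eq κ t, logMGF, hS.lintegral_exp_inner_comp hτ hind θ, hexp, logMGF]
    congr 1
    refine lintegral_congr_ae ?_
    filter_upwards [hV.nonneg] with ω hω
    rw [ENNReal.ofReal_rpow_of_pos (Real.exp_pos _), ← Real.exp_mul, Real.coe_toNNReal _ (hω t),
      real_inner_comm]
    rfl

/-- The composition of the two log moment generating functions is finite near the origin. -/
theorem zero_mem_interior_effDomain_compTop [FiniteDimensional ℝ E] (hS : Measurable (S 1))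
    (hS_fin : ∀ᶠ θ in 𝓝 (0 : E), logMGF (S 1) P θ < ⊤)
    (hV_fin : ∀ᶠ η in 𝓝 (0 : ℝ), logMGF (V 1) P η < ⊤) :
    (0 : E) ∈ interior (effDomain (compTop (logMGF (V 1) P) (logMGF (S 1) P))) := by
  rw [mem_interior_iff_mem_nhds]
  have hconv := convexOn_toReal (logMGF_ne_bot (S 1) P hS) fun a b ha hb hab x y =>
    logMGF_combo_le hS.aemeasurable ha hb hab x y
  have h0 : (0 : E) ∈ interior (effDomain (logMGF (S 1) P)) :=
    mem_interior_iff_mem_nhds.2 hS_fin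
  have hcont := hconv.continuousOn_interior.continuousAt (isOpen_interior.mem_nhds h0)
  -- `κ_S` is continuous at `0` with value `0`, so nearby values stay where `κ_V` is finite.
  have hlim : Tendsto (fun θ => (logMGF (S 1) P θ).toReal) (𝓝 0) (𝓝 0) := by
    simpa [ContinuousAt, logMGF_zero] using hcont
  filter_upwards [hS_fin, hlim.eventually hV_fin] with θ h1 h2
  change compTop _ _ θ < ⊤
  rw [compTop, if_neg h1.ne]
  exact h2

end Subordination

end LevyLDP

/-! ### The large deviation principle -/

theorem mainTheorem10 {Ω : Type*} [MeasurableSpace Ω] (P : Measure Ω) [IsProbabilityMeasure P]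
    (h : ℕ) (S : ℝ≥0 → Ω → EuclideanSpace ℝ (Fin h)) (V : ℝ≥0 → Ω → ℝ)
    (hS : LevyLDP.IsLevyProcess S P)
    (hS_fin : ∀ᶠ θ in 𝓝 (0 : EuclideanSpace ℝ (Fin h)), LevyLDP.logMGF (S 1) P θ < ⊤)
    (hV : LevyLDP.IsSubordinator V P)
    (hV_fin : ∀ᶠ η in 𝓝 (0 : ℝ), LevyLDP.logMGF (V 1) P η < ⊤)
    (hV_pos : 0 < deriv (fun η : ℝ => (LevyLDP.logMGF (V 1) P η).toReal) 0)
    (hSV : IndepFun (fun ω t => S t ω) (fun ω t => V t ω) P)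
    (hsmooth : LevyLDP.EssentiallySmooth
      (LevyLDP.compTop (LevyLDP.logMGF (V 1) P) (LevyLDP.logMGF (S 1) P))) :
    LevyLDP.IsGoodRateFunction
      (LevyLDP.legendre (LevyLDP.compTop (LevyLDP.logMGF (V 1) P) (LevyLDP.logMGF (S 1) P))) ∧
    LevyLDP.SatisfiesLDP P
      (fun t ω => (t : ℝ)⁻¹ • S (V t ω).toNNReal ω)
      (fun t => (t : ℝ))
      (LevyLDP.legendre (LevyLDP.compTop (LevyLDP.logMGF (V 1) P) (LevyLDP.logMGF (S 1) P))) := by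
  set Λ := LevyLDP.compTop (LevyLDP.logMGF (V 1) P) (LevyLDP.logMGF (S 1) P) with hΛdef
  have hΛ : ∀ t : ℝ≥0, 0 < t → ∀ θ,
      LevyLDP.logMGF (fun ω => S (V t ω).toNNReal ω) P θ = ((t : ℝ) : EReal) * Λ θ :=
    fun t ht θ => LevyLDP.logMGF_subordinated hS hV hV_pos hSV ht θ
  have hZ : ∀ t, AEMeasurable (fun ω => S (V t ω).toNNReal ω) P := fun t =>
    hS.aemeasurable_comp (hV.levy.measurable t).real_toNNReal
  -- Time `1` exhibits `Λ` as a log moment generating function, so its convexity needs no analysis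
  -- of the composition.
  have hΛ1 : LevyLDP.logMGF (fun ω => S (V 1 ω).toNNReal ω) P = Λ := by
    funext θ
    simpa using hΛ 1 one_pos θ
  have hlsc : LowerSemicontinuous Λ := hΛ1 ▸ LevyLDP.lowerSemicontinuous_logMGF (hZ 1)
  have hconv : ConvexOn ℝ (LevyLDP.effDomain Λ) fun θ => (Λ θ).toReal := by
    refine LevyLDP.convexOn_toReal hsmooth.ne_bot fun a b ha hb hab x y => ?_
    rw [← hΛ1]
    exact LevyLDP.logMGF_combo_le (hZ 1) ha hb hab x y
  have hzero : Λ 0 = 0 := by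
    rw [← hΛ1]
    exact LevyLDP.logMGF_zero
  have h0 : 0 ∈ interior (LevyLDP.effDomain Λ) :=
    LevyLDP.zero_mem_interior_effDomain_compTop (hS.measurable 1) hS_fin hV_fin
  have hgood := LevyLDP.isGoodRateFunction_legendre hsmooth.ne_bot hzero h0
  exact ⟨hgood, {
    aemeasurable := fun t => (hZ t).const_smul (t : ℝ)⁻¹
    speed := NNReal.tendsto_coe_atTop.2 tendsto_id
    rate := hgood.toIsRateFunction
    upper := fun C hC => LevyLDP.limsup_log_measure_le hZ hsmooth.ne_bot hΛ h0 hC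
    lower := fun O hO => LevyLDP.le_liminf_log_measure hZ hsmooth hlsc hconv hΛ hzero h0 hO }⟩
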